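/- Let $d \geq 2$, let $S^1=\{e^{2\pi i\theta}\}$, and let $$S^1 \times S^{2d} = \{(e^{2\pi i \theta}, z_1, \ldots, z_d, h) \in S^1 \times \mathbb{C}^d \times \mathbb{R} \mid \textstyle\sum_{j=1}^d |z_j|^2 + h^2 = 1\}$$ with the contact structure $\ker\beta$, where $$\beta = h\,d\theta + \frac{i}{4}\sum_{j=1}^d (z_j\, d\bar z_j - \bar z_j\, dz_j),$$ and with the toric action of $T^{d+1}$ given by $$(t_0, t_1, \ldots, t_d) * (e^{2\pi i\theta}, z_1, \ldots, z_d, h) = (t_0 e^{2\pi i\theta}, t_1 z_1, \ldots, t_d z_d, h).$$ A pre-Lagrangian toric fiber is a generic (that is, $(d+1)$-dimensional) orbit of this action. A subset $L$ is called displaceable if there is a contact isotopy $(\varphi_t)_{t \in [0,1]}$ of $(S^1 \times S^{2d}, \ker \beta)$, i.e. a smooth family of diffeomorphisms preserving $\ker\beta$, with $\varphi_0 = \mathrm{id}$ and $\varphi_1(L) \cap L = \emptyset$. Then there exists an open neighborhood $U$ of $S^1 \times \{h = 0\}$ in $S^1 \times S^{2d}$ such that every pre-Lagrangian toric fiber contained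 in $U$ is displaceable. -/

import Mathlib

open scoped Manifold ContDiff ComplexConjugate

noncomputable section

namespace ContactToric

/-- The Euclidean space `ℂ^d × ℝ`, with its points written `(z₁, …, z_d, h)`. -/
abbrev Ambient (d : ℕ) : Type := WithLp 2 (EuclideanSpace ℂ (Fin d) × ℝ)

instance factFinrankAmbient (d : ℕ) : Fact (Module.finrank ℝ (Ambient d) = 2 * d + 1) := by
  refine ⟨?_⟩
  have e : Module.finrank ℝ (Ambient d)
      = Module.finrank ℝ (EuclideanSpace ℂ (Fin d) × ℝ) :=
    LinearEquiv.finrank_eq (WithLp.linearEquiv 2 ℝ (EuclideanSpace ℂ (Fin d) × ℝ))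
  rw [e, Module.finrank_prod, ← Module.finrank_mul_finrank ℝ ℂ (EuclideanSpace ℂ (Fin d))]
  simp

/-- The manifold `S¹ × S^{2d}`, where `S^{2d}` is the unit sphere of `ℂ^d × ℝ`. -/
abbrev V (d : ℕ) : Type := Circle × Metric.sphere (0 : Ambient d) 1

/-- The model with corners of the (boundaryless) smooth manifold `S¹ × S^{2d}`. -/
abbrev model (d : ℕ) := (𝓡 1).prod (𝓡 (2 * d))

/-- The coordinate `z_j` of a point of `S¹ × S^{2d}`. -/
def zCoord {d : ℕ} (p : V d) (j : Fin d) : ℂ := (p.2 : Ambient d).fst j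

/-- The coordinate `h` of a point of `S¹ × S^{2d}`. -/
def hCoord {d : ℕ} (p : V d) : ℝ := (p.2 : Ambient d).snd

/-- The inclusion of `S¹ × S^{2d}` in `ℂ × (ℂ^d × ℝ)`. -/
def incl (d : ℕ) (p : V d) : ℂ × Ambient d := ((p.1 : ℂ), (p.2 : Ambient d))

/-- The contact form
`β = h dθ + (i/4) ∑ⱼ (zⱼ dz̄ⱼ - z̄ⱼ dzⱼ) = h dθ + (1/2) ∑ⱼ (xⱼ dyⱼ - yⱼ dxⱼ)`
on `S¹ × S^{2d}`, evaluated at a tangent vector `v` at `p = (u, z, h)`, `u = e^{2πiθ}`.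
If `w` is the image of `v` in `ℂ × (ℂ^d × ℝ)`, then `dθ(v) = Im(ū w_u) / (2π)` and
`(xⱼ dyⱼ - yⱼ dxⱼ)(v) = Im(z̄ⱼ wⱼ)`. -/
def beta {d : ℕ} (p : V d) (v : TangentSpace (model d) p) : ℝ :=
  let w : ℂ × Ambient d := mfderiv (model d) 𝓘(ℝ, ℂ × Ambient d) (incl d) p v
  hCoord p * ((conj (p.1 : ℂ) * w.1).im / (2 * Real.pi))
    + 1 / 2 * ∑ j : Fin d, (conj (zCoord p j) * w.2.fst j).im

/-- A diffeomorphism `f` of `S¹ × S^{2d}` with `df(ker β) = ker β`. -/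
def IsContactomorphism {d : ℕ} (f : V d ≃ₘ^∞⟮model d, model d⟯ V d) : Prop :=
  ∀ (p : V d) (v : TangentSpace (model d) p),
    beta (f p) (mfderiv (model d) (model d) f p v) = 0 ↔ beta p v = 0

/-- A contact isotopy `φ_t`, `t ∈ [0,1]`, of `(S¹ × S^{2d}, ker β)` starting at the identity.
The values of `φ` outside `[0,1]` are irrelevant. -/
structure IsContactIsotopy {d : ℕ} (φ : ℝ → (V d ≃ₘ^∞⟮model d, model d⟯ V d)) : Prop where
  smooth : ContMDiffOn (𝓘(ℝ, ℝ).prod (model d)) (model d) ∞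
    (fun q : ℝ × V d => φ q.1 q.2) (Set.Icc (0 : ℝ) 1 ×ˢ Set.univ)
  contact : ∀ t ∈ Set.Icc (0 : ℝ) 1, IsContactomorphism (φ t)
  start : ∀ p, φ 0 p = p

/-- A subset `L` is displaceable if `φ₁(L) ∩ L = ∅` for some contact isotopy `φ_t` starting at
the identity. -/
def IsDisplaceable {d : ℕ} (L : Set (V d)) : Prop :=
  ∃ φ : ℝ → (V d ≃ₘ^∞⟮model d, model d⟯ V d), IsContactIsotopy φ ∧ (φ 1 '' L) ∩ L = ∅

/-- The torus `T^{d+1}`, with its elements written `(t₀, (t₁, …, t_d))`. -/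
abbrev Torus (d : ℕ) : Type := Circle × (Fin d → Circle)

/-- The rotation `(z, h) ↦ (t₁ z₁, …, t_d z_d, h)` of `ℂ^d × ℝ`. -/
def rotate {d : ℕ} (t : Fin d → Circle) (x : Ambient d) : Ambient d :=
  WithLp.toLp 2 (WithLp.toLp 2 (fun j => (t j : ℂ) * x.fst j), x.snd)

theorem norm_rotate {d : ℕ} (t : Fin d → Circle) (x : Ambient d) : ‖rotate t x‖ = ‖x‖ := by
  simp [rotate, WithLp.prod_norm_eq_of_L2, EuclideanSpace.norm_eq, Circle.norm_coe]

/-- The toric action of `T^{d+1}` on `S¹ × S^{2d}`,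
`(t₀, …, t_d) * (u, z₁, …, z_d, h) = (t₀ u, t₁ z₁, …, t_d z_d, h)`. -/
instance toricAction (d : ℕ) : MulAction (Torus d) (V d) where
  smul t p := (t.1 * p.1, ⟨rotate t.2 p.2, by
    have h := p.2.2
    rw [mem_sphere_zero_iff_norm] at h ⊢
    rw [norm_rotate, h]⟩)
  one_smul p := by
    refine Prod.ext (one_mul _) (Subtype.ext ?_)
    change rotate 1 (p.2 : Ambient d) = p.2
    simp only [rotate, Pi.one_apply, Circle.coe_one, one_mul]
    rfl
  mul_smul s t p := by
    refine Prod.ext (mul_assoc _ _ _) (Subtype.ext ?_)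
    change rotate (s.2 * t.2) (p.2 : Ambient d) = rotate s.2 (rotate t.2 p.2)
    simp [rotate, mul_assoc]

/-- The pre-Lagrangian toric fibers of `S¹ × S^{2d}`, i.e. the generic (that is,
`(d+1)`-dimensional) orbits of `T^{d+1}`: an orbit of a torus has full dimension exactly when
its points have finite stabilizers. -/
def IsPreLagrangianToricFiber {d : ℕ} (L : Set (V d)) : Prop :=
  ∃ p : V d, Finite (MulAction.stabilizer (Torus d) p) ∧ L = MulAction.orbit (Torus d) p

/-- The subset `S¹ × {h = 0}` of `S¹ × S^{2d}`. -/
def equator (d : ℕ) : Set (V d) := {p | hCoord p = 0}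

end ContactToric

end

/-! Fix an index i. The weighted scaling (z, h) ↦ (r z, r² h) multiplies β by r², even when r varies
from point to point, so away from the locus z_j = 0 for all j ≠ i the sphere can be replaced by the
slice ∑_{j ≠ i} |z_j|² = 1 without changing the contact structure. On the slice, a common rotation
of the z_j, j ≠ i, by an angle α adds dα / 2 to the form. The remaining terms h dθ + (1/2) Im(z̄_i
dz_i) are a primitive of a symplectic form on T*S¹ × ℂ, so the slice behaves like a prequantization
of T*S¹ × ℂ, and Hamiltonian flows downstairs lift to contact flows once the right α is chosen.

The Hamiltonian used is a function of E = |z_i - c|² + h². Its flow preserves E and h, rotates z_i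
about c and turns the circle factor. The function is linear for E ≤ R, where time one is the
reflection z_i ↦ 2c - z_i, and vanishes for E ≥ R + 1. On the sphere, approaching the excluded locus
forces E to infinity, so the flow extends by the identity (`exists_flow_eq_self`). The contact
property is `isConformalAt_sliceFlow`, transported by `exists_isConformalAt_flow` and
`beta_mfderiv`.

A generic orbit has all z_j nonzero, hence meets the slice picture when d ≥ 2, and there it lies
over a circle |z_i| = ρ. With c = ρ + 1 the reflected circle is disjoint from the original one. The
value of h plays no role, so every toric fiber is displaced and U can be the whole manifold. -/

noncomputable section

namespace ContactToric

/-! ### Weighted scalings of `ℂ^d × ℝ` -/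

/-- The weighted scaling `(z, h) ↦ (r z, r² h)`. -/
def wscale {d : ℕ} (r : ℝ) (x : Ambient d) : Ambient d :=
  WithLp.toLp 2 (WithLp.toLp 2 (fun j => (r : ℂ) * x.fst j), r ^ 2 * x.snd)

@[simp] theorem wscale_fst {d : ℕ} (r : ℝ) (x : Ambient d) (j : Fin d) :
    (wscale r x).fst j = r * x.fst j := rfl

@[simp] theorem wscale_snd {d : ℕ} (r : ℝ) (x : Ambient d) :
    (wscale r x).snd = r ^ 2 * x.snd := rfl

theorem ambient_ext {d : ℕ} {x y : Ambient d} (h : ∀ j, x.fst j = y.fst j)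
    (h' : x.snd = y.snd) : x = y := by
  apply WithLp.ofLp_injective
  exact Prod.ext (by ext j; exact h j) h'

theorem wscale_wscale {d : ℕ} (r s : ℝ) (x : Ambient d) :
    wscale r (wscale s x) = wscale (r * s) x :=
  ambient_ext (fun j => by simp [mul_assoc]) (by simp; ring)

@[simp] theorem wscale_one {d : ℕ} (x : Ambient d) : wscale 1 x = x :=
  ambient_ext (fun j => by simp) (by simp)

/-- The squared norm `∑_{j ≠ i} |z_j|²`. -/
def restNormSq {d : ℕ} (i : Fin d) (x : Ambient d) : ℝ :=
  ∑ j ∈ Finset.univ.erase i, Complex.normSq (x.fst j)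

/-- The squared norm `∑_j |z_j|²`. -/
def zNormSq {d : ℕ} (x : Ambient d) : ℝ := ∑ j, Complex.normSq (x.fst j)

theorem zNormSq_eq {d : ℕ} (i : Fin d) (x : Ambient d) :
    zNormSq x = Complex.normSq (x.fst i) + restNormSq i x :=
  (Finset.add_sum_erase _ _ (Finset.mem_univ i)).symm

theorem restNormSq_nonneg {d : ℕ} (i : Fin d) (x : Ambient d) : 0 ≤ restNormSq i x :=
  Finset.sum_nonneg fun _ _ => Complex.normSq_nonneg _

theorem zNormSq_pos {d : ℕ} {i : Fin d} {x : Ambient d} (h : 0 < restNormSq i x) :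
    0 < zNormSq x := by
  rw [zNormSq_eq i]
  linarith [Complex.normSq_nonneg (x.fst i)]

theorem restNormSq_wscale {d : ℕ} (i : Fin d) (r : ℝ) (x : Ambient d) :
    restNormSq i (wscale r x) = r ^ 2 * restNormSq i x := by
  simp only [restNormSq, wscale_fst, Complex.normSq_mul, Complex.normSq_ofReal, Finset.mul_sum]
  exact Finset.sum_congr rfl fun j _ => by ring

theorem zNormSq_wscale {d : ℕ} (r : ℝ) (x : Ambient d) :
    zNormSq (wscale r x) = r ^ 2 * zNormSq x := by
  simp only [zNormSq, wscale_fst, Complex.normSq_mul, Complex.normSq_ofReal, Finset.mul_sum]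
  exact Finset.sum_congr rfl fun j _ => by ring

theorem norm_sq_ambient {d : ℕ} (x : Ambient d) : ‖x‖ ^ 2 = zNormSq x + x.snd ^ 2 := by
  rw [WithLp.prod_norm_sq_eq_of_L2, EuclideanSpace.norm_sq_eq]
  simp [zNormSq, Complex.normSq_eq_norm_sq]

theorem norm_eq_one_iff {d : ℕ} (x : Ambient d) : ‖x‖ = 1 ↔ zNormSq x + x.snd ^ 2 = 1 := by
  rw [← norm_sq_ambient]
  constructor
  · intro h; simp [h]
  · intro h; nlinarith [norm_nonneg x]

/-- The number `σ > 0` for which `wscale σ x` lies on the unit sphere. -/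
def sphereFactor {d : ℕ} (x : Ambient d) : ℝ :=
  √(2 / (zNormSq x + √(zNormSq x ^ 2 + 4 * x.snd ^ 2)))

/-- The projection to the unit sphere along the weighted scalings. -/
def toSphere {d : ℕ} (x : Ambient d) : Ambient d := wscale (sphereFactor x) x

theorem sphereFactor_pos {d : ℕ} {x : Ambient d} (hx : 0 < zNormSq x) : 0 < sphereFactor x := by
  unfold sphereFactor; positivity

/-- The square s of the scaling factor must solve h² s² + |z|² s = 1. The positive root is taken in
rationalised form, so that the formula persists, smoothly, at h = 0. -/
theorem norm_toSphere {d : ℕ} {x : Ambient d} (hx : 0 < zNormSq x) : ‖toSphere x‖ = 1 := by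
  rw [norm_eq_one_iff, toSphere, zNormSq_wscale, wscale_snd, sphereFactor,
    Real.sq_sqrt (by positivity)]
  have hk : √(zNormSq x ^ 2 + 4 * x.snd ^ 2) ^ 2 = zNormSq x ^ 2 + 4 * x.snd ^ 2 :=
    Real.sq_sqrt (by positivity)
  have hk0 := Real.sqrt_nonneg (zNormSq x ^ 2 + 4 * x.snd ^ 2)
  generalize √(zNormSq x ^ 2 + 4 * x.snd ^ 2) = k at *
  have : zNormSq x + k ≠ 0 := by positivity
  field_simp
  linear_combination -hk

theorem wscale_injective_of_norm {d : ℕ} {x : Ambient d} (hx : 0 < zNormSq x) {r s : ℝ}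
    (hr : 0 < r) (hs : 0 < s) (h : ‖wscale r x‖ = 1) (h' : ‖wscale s x‖ = 1) : r = s := by
  rw [norm_eq_one_iff, zNormSq_wscale, wscale_snd] at h h'
  have e : (r - s) * ((r + s) * (zNormSq x + (r ^ 2 + s ^ 2) * x.snd ^ 2)) = 0 := by
    linear_combination h - h'
  have : 0 < (r + s) * (zNormSq x + (r ^ 2 + s ^ 2) * x.snd ^ 2) := by positivity
  rcases mul_eq_zero.1 e with h | h
  · linarith
  · exact absurd h this.ne'

theorem toSphere_eq_of_norm {d : ℕ} {x : Ambient d} (hx : 0 < zNormSq x) {r : ℝ} (hr : 0 < r)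
    (h : ‖wscale r x‖ = 1) : toSphere x = wscale r x := by
  rw [toSphere, wscale_injective_of_norm hx (sphereFactor_pos hx) hr (norm_toSphere hx) h]

/-- The projection to the slice `∑_{j ≠ i} |z_j|² = 1` along the weighted scalings. -/
def toSlice {d : ℕ} (i : Fin d) (x : Ambient d) : Ambient d := wscale (√(restNormSq i x))⁻¹ x

theorem restNormSq_toSlice {d : ℕ} {i : Fin d} {x : Ambient d} (hx : 0 < restNormSq i x) :
    restNormSq i (toSlice i x) = 1 := by
  rw [toSlice, restNormSq_wscale, inv_pow, Real.sq_sqrt hx.le, inv_mul_cancel₀ hx.ne']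

theorem toSlice_eq_self {d : ℕ} {i : Fin d} {x : Ambient d} (hx : restNormSq i x = 1) :
    toSlice i x = x := by
  simp [toSlice, hx]

theorem toSlice_wscale {d : ℕ} {i : Fin d} {x : Ambient d} {r : ℝ}
    (hr : 0 < r) : toSlice i (wscale r x) = toSlice i x := by
  rw [toSlice, restNormSq_wscale, wscale_wscale, Real.sqrt_mul (by positivity),
    Real.sqrt_sq hr.le, toSlice]
  congr 1
  field_simp

theorem toSphere_toSlice {d : ℕ} {i : Fin d} {x : Ambient d} (hx : 0 < restNormSq i x)
    (h : ‖x‖ = 1) : toSphere (toSlice i x) = x := by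
  have hs : 0 < √(restNormSq i x) := by positivity
  have e : wscale (√(restNormSq i x)) (toSlice i x) = x := by
    rw [toSlice, wscale_wscale, mul_inv_cancel₀ hs.ne', wscale_one]
  rw [toSphere_eq_of_norm (zNormSq_pos (i := i) _) hs (by rw [e, h]), e]
  rw [restNormSq_toSlice hx]; exact one_pos

theorem toSlice_toSphere {d : ℕ} {i : Fin d} {x : Ambient d} (hx : restNormSq i x = 1) :
    toSlice i (toSphere x) = x := by
  rw [toSphere, toSlice_wscale, toSlice_eq_self hx]
  exact sphereFactor_pos (zNormSq_pos (i := i) (by rw [hx]; exact one_pos))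

theorem restNormSq_toSphere_pos {d : ℕ} {i : Fin d} {x : Ambient d} (hx : 0 < restNormSq i x) :
    0 < restNormSq i (toSphere x) := by
  have := sphereFactor_pos (zNormSq_pos hx)
  rw [toSphere, restNormSq_wscale]
  positivity

/-! ### Smoothness in `ℂ^d × ℝ` -/

section Smooth

variable {E : Type*} [NormedAddCommGroup E] [NormedSpace ℝ E] {d : ℕ}

theorem contDiff_fst_apply (j : Fin d) : ContDiff ℝ ∞ (fun x : Ambient d => x.fst j) :=
  ((EuclideanSpace.proj (𝕜 := ℂ) j).restrictScalars ℝ ∘L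
    (ContinuousLinearMap.fst ℝ _ _) ∘L
      (WithLp.prodContinuousLinearEquiv 2 ℝ (EuclideanSpace ℂ (Fin d)) ℝ).toContinuousLinearMap
    ).contDiff

theorem contDiff_height : ContDiff ℝ ∞ (fun x : Ambient d => x.snd) :=
  ((ContinuousLinearMap.snd ℝ _ _) ∘L
      (WithLp.prodContinuousLinearEquiv 2 ℝ (EuclideanSpace ℂ (Fin d)) ℝ).toContinuousLinearMap
    ).contDiff

theorem contDiffAt_ambient {f : E → Ambient d} {a : E}
    (h : ∀ j, ContDiffAt ℝ ∞ (fun e => (f e).fst j) a)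
    (h' : ContDiffAt ℝ ∞ (fun e => (f e).snd) a) : ContDiffAt ℝ ∞ f a := by
  have h1 : ContDiffAt ℝ ∞ (fun e => (f e).fst) a := contDiffAt_piLp' 2 h
  exact (WithLp.prodContinuousLinearEquiv 2 ℝ (EuclideanSpace ℂ (Fin d)) ℝ).symm.contDiff.contDiffAt.comp
    a (h1.prodMk h')

theorem contDiff_normSq : ContDiff ℝ ∞ Complex.normSq := by
  have : (Complex.normSq : ℂ → ℝ) = fun z => z.re * z.re + z.im * z.im := by
    ext z; exact Complex.normSq_apply z
  rw [this]
  have h1 : ContDiff ℝ ∞ Complex.re := Complex.reCLM.contDiff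
  have h2 : ContDiff ℝ ∞ Complex.im := Complex.imCLM.contDiff
  exact (h1.mul h1).add (h2.mul h2)

theorem contDiff_restNormSq (i : Fin d) : ContDiff ℝ ∞ (restNormSq i) :=
  ContDiff.sum fun j _ => contDiff_normSq.comp (contDiff_fst_apply j)

theorem contDiff_zNormSq : ContDiff ℝ ∞ (zNormSq (d := d)) :=
  ContDiff.sum fun j _ => contDiff_normSq.comp (contDiff_fst_apply j)

theorem contDiff_complex_ofReal : ContDiff ℝ ∞ (fun r : ℝ => (r : ℂ)) :=
  Complex.ofRealCLM.contDiff

theorem contDiffAt_wscale {r : E → ℝ} {f : E → Ambient d} {a : E} (hr : ContDiffAt ℝ ∞ r a)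
    (hf : ContDiffAt ℝ ∞ f a) : ContDiffAt ℝ ∞ (fun e => wscale (r e) (f e)) a := by
  refine contDiffAt_ambient (fun j => ?_) ?_
  · exact (contDiff_complex_ofReal.contDiffAt.comp a hr).mul
      ((contDiff_fst_apply j).contDiffAt.comp a hf)
  · exact (hr.pow 2).mul (contDiff_height.contDiffAt.comp a hf)

theorem contDiffAt_sphereFactor {x : Ambient d} (hx : 0 < zNormSq x) :
    ContDiffAt ℝ ∞ sphereFactor x := by
  have h1 : ContDiffAt ℝ ∞ (zNormSq (d := d)) x := contDiff_zNormSq.contDiffAt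
  have h2 : ContDiffAt ℝ ∞ (fun x : Ambient d => x.snd) x := contDiff_height.contDiffAt
  have h3 : ContDiffAt ℝ ∞ (fun x : Ambient d => √(zNormSq x ^ 2 + 4 * x.snd ^ 2)) x :=
    ((h1.pow 2).add (contDiffAt_const.mul (h2.pow 2))).sqrt (by positivity)
  have h4 : 0 < zNormSq x + √(zNormSq x ^ 2 + 4 * x.snd ^ 2) := by positivity
  exact (contDiffAt_const.div (h1.add h3) h4.ne').sqrt (div_pos two_pos h4).ne'

theorem contDiffAt_toSphere {x : Ambient d} (hx : 0 < zNormSq x) :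
    ContDiffAt ℝ ∞ toSphere x :=
  contDiffAt_wscale (contDiffAt_sphereFactor hx) contDiffAt_id

theorem contDiffAt_sliceFactor {i : Fin d} {x : Ambient d} (hx : 0 < restNormSq i x) :
    ContDiffAt ℝ ∞ (fun x => (√(restNormSq i x))⁻¹) x :=
  ((contDiff_restNormSq i).contDiffAt.sqrt hx.ne').inv (by positivity)

theorem contDiffAt_toSlice {i : Fin d} {x : Ambient d} (hx : 0 < restNormSq i x) :
    ContDiffAt ℝ ∞ (toSlice i) x :=
  contDiffAt_wscale (contDiffAt_sliceFactor hx) contDiffAt_id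

end Smooth

/-! ### The isotopy of the slice -/

/-- A smooth function equal to `π u` for `u ≤ R` and to `0` for `u ≥ R + 1`. -/
def profile (R u : ℝ) : ℝ := Real.pi * u * Real.smoothTransition (R + 1 - u)

/-- The derivative of `profile`. -/
def speed (R u : ℝ) : ℝ := deriv (profile R) u

theorem contDiff_profile (R : ℝ) : ContDiff ℝ ∞ (profile R) :=
  (contDiff_const.mul contDiff_id).mul
    (Real.smoothTransition.contDiff.comp (contDiff_const.sub contDiff_id))

theorem contDiff_speed (R : ℝ) : ContDiff ℝ ∞ (speed R) :=
  (contDiff_infty_iff_deriv.1 (contDiff_profile R)).2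

theorem hasDerivAt_profile (R u : ℝ) : HasDerivAt (profile R) (speed R u) u :=
  ((contDiff_profile R).differentiable (by simp) u).hasDerivAt

theorem speed_of_lt {R u : ℝ} (h : u < R) : speed R u = Real.pi := by
  have : profile R =ᶠ[nhds u] fun v => Real.pi * v := by
    filter_upwards [Iio_mem_nhds h] with v hv
    rw [profile, Real.smoothTransition.one_of_one_le (by linarith [Set.mem_Iio.1 hv]), mul_one]
  rw [speed, this.deriv_eq]
  simp

/-- Vanishing of the derivative alone would not suffice: the lifted angle contains the profile
itself, so a nonzero constant value would leave a rotation of the z_j. -/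
theorem profile_of_lt {R u : ℝ} (h : R + 1 < u) : profile R u = 0 := by
  rw [profile, Real.smoothTransition.zero_of_nonpos (by linarith), mul_zero]

theorem speed_of_gt {R u : ℝ} (h : R + 1 < u) : speed R u = 0 := by
  have : profile R =ᶠ[nhds u] fun _ => 0 := by
    filter_upwards [Ioi_mem_nhds h] with v hv
    exact profile_of_lt hv
  rw [speed, this.deriv_eq, deriv_const]

section

variable {d : ℕ}

/-- The function `|z_i - c|² + h²`. -/
def energy (i : Fin d) (c : ℝ) (x : Ambient d) : ℝ :=
  Complex.normSq (x.fst i - c) + x.snd ^ 2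

/-- The displacement `z_i - c` rotated by the angle `t · speed`. -/
def turned (i : Fin d) (c R t : ℝ) (x : Ambient d) : ℂ :=
  Complex.exp (((t * speed R (energy i c x) : ℝ) : ℂ) * Complex.I) * (x.fst i - c)

/-- The angle by which the coordinates `z_j`, `j ≠ i`, are rotated. -/
def phase (i : Fin d) (c R t : ℝ) (x : Ambient d) : ℝ :=
  -c * ((turned i c R t x).im - (x.fst i - c).im)
    - t * (x.snd ^ 2 * speed R (energy i c x)
      + (energy i c x * speed R (energy i c x) - profile R (energy i c x)))

/-- The angle by which the circle factor is rotated. -/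
def shift (i : Fin d) (c R t : ℝ) (x : Ambient d) : ℝ :=
  2 * Real.pi * (t * (x.snd * speed R (energy i c x)))

/-- The map rotating `z_i` about `c` by an angle depending on `energy`, with the compensating
rotation of the other coordinates. -/
def sliceFlow (i : Fin d) (c R t : ℝ) (x : Ambient d) : Ambient d :=
  WithLp.toLp 2 (WithLp.toLp 2 (fun j => if j = i then c + turned i c R t x
    else Complex.exp ((phase i c R t x : ℂ) * Complex.I) * x.fst j), x.snd)

@[simp] theorem sliceFlow_fst_self (i : Fin d) (c R t : ℝ) (x : Ambient d) :
    (sliceFlow i c R t x).fst i = c + turned i c R t x := if_pos rfl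

theorem sliceFlow_fst_of_ne {i j : Fin d} (h : j ≠ i) (c R t : ℝ) (x : Ambient d) :
    (sliceFlow i c R t x).fst j = Complex.exp ((phase i c R t x : ℂ) * Complex.I) * x.fst j :=
  if_neg h

@[simp] theorem sliceFlow_snd (i : Fin d) (c R t : ℝ) (x : Ambient d) :
    (sliceFlow i c R t x).snd = x.snd := rfl

theorem normSq_exp_ofReal_mul_I (r : ℝ) : Complex.normSq (Complex.exp (r * Complex.I)) = 1 := by
  rw [Complex.normSq_eq_norm_sq, Complex.norm_exp_ofReal_mul_I, one_pow]

theorem restNormSq_sliceFlow (i : Fin d) (c R t : ℝ) (x : Ambient d) :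
    restNormSq i (sliceFlow i c R t x) = restNormSq i x := by
  refine Finset.sum_congr rfl fun j hj => ?_
  rw [sliceFlow_fst_of_ne (Finset.ne_of_mem_erase hj), Complex.normSq_mul,
    normSq_exp_ofReal_mul_I, one_mul]

theorem energy_sliceFlow (i : Fin d) (c R t : ℝ) (x : Ambient d) :
    energy i c (sliceFlow i c R t x) = energy i c x := by
  rw [energy, sliceFlow_fst_self, add_sub_cancel_left, turned, Complex.normSq_mul,
    normSq_exp_ofReal_mul_I, one_mul, sliceFlow_snd, energy]

/-- The rotation speed depends only on the conserved quantity E, so successive rotations add up.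
This is the source of the one-parameter group law, which later supplies the inverse diffeomorphism.
-/
theorem turned_sliceFlow (i : Fin d) (c R s t : ℝ) (x : Ambient d) :
    turned i c R s (sliceFlow i c R t x) = turned i c R (s + t) x := by
  rw [turned, energy_sliceFlow, sliceFlow_fst_self, add_sub_cancel_left, turned, turned,
    ← mul_assoc, ← Complex.exp_add]
  congr 2
  push_cast
  ring

theorem phase_sliceFlow (i : Fin d) (c R s t : ℝ) (x : Ambient d) :
    phase i c R s (sliceFlow i c R t x) + phase i c R t x = phase i c R (s + t) x := by
  simp only [phase, turned_sliceFlow, energy_sliceFlow, sliceFlow_fst_self, add_sub_cancel_left,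
    sliceFlow_snd]
  ring

theorem shift_sliceFlow (i : Fin d) (c R s t : ℝ) (x : Ambient d) :
    shift i c R s (sliceFlow i c R t x) + shift i c R t x = shift i c R (s + t) x := by
  simp only [shift, energy_sliceFlow, sliceFlow_snd]
  ring

theorem sliceFlow_add (i : Fin d) (c R s t : ℝ) (x : Ambient d) :
    sliceFlow i c R s (sliceFlow i c R t x) = sliceFlow i c R (s + t) x := by
  refine ambient_ext (fun j => ?_) rfl
  by_cases h : j = i
  · subst h
    simp [turned_sliceFlow]
  · rw [sliceFlow_fst_of_ne h, sliceFlow_fst_of_ne h, sliceFlow_fst_of_ne h, ← mul_assoc,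
      ← Complex.exp_add, ← phase_sliceFlow i c R s t x]
    congr 2
    push_cast
    ring

theorem turned_of_speed_eq_zero {i : Fin d} {c R t : ℝ} {x : Ambient d}
    (h : t * speed R (energy i c x) = 0) : turned i c R t x = x.fst i - c := by
  simp [turned, h]

theorem shift_zero (i : Fin d) (c R : ℝ) (x : Ambient d) : shift i c R 0 x = 0 := by
  simp [shift]

theorem sliceFlow_of_phase_eq_zero {i : Fin d} {c R t : ℝ} {x : Ambient d}
    (h : t * speed R (energy i c x) = 0) (h' : phase i c R t x = 0) :
    sliceFlow i c R t x = x := by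
  refine ambient_ext (fun j => ?_) rfl
  by_cases hj : j = i
  · subst hj
    simp [turned_of_speed_eq_zero h]
  · simp [sliceFlow_fst_of_ne hj, h']

theorem sliceFlow_zero (i : Fin d) (c R : ℝ) (x : Ambient d) : sliceFlow i c R 0 x = x := by
  have h : (0 : ℝ) * speed R (energy i c x) = 0 := zero_mul _
  exact sliceFlow_of_phase_eq_zero h (by simp [phase, turned_of_speed_eq_zero h])

theorem sliceFlow_of_energy_gt {i : Fin d} {c R : ℝ} (t : ℝ) {x : Ambient d}
    (hx : R + 1 < energy i c x) : sliceFlow i c R t x = x := by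
  have h : t * speed R (energy i c x) = 0 := by rw [speed_of_gt hx, mul_zero]
  exact sliceFlow_of_phase_eq_zero h
    (by simp [phase, turned_of_speed_eq_zero h, speed_of_gt hx, profile_of_lt hx])

theorem shift_of_energy_gt {i : Fin d} {c R : ℝ} (t : ℝ) {x : Ambient d}
    (hx : R + 1 < energy i c x) : shift i c R t x = 0 := by
  simp [shift, speed_of_gt hx]

theorem sliceFlow_one_of_energy_lt {i : Fin d} {c R : ℝ} {x : Ambient d}
    (hx : energy i c x < R) : (sliceFlow i c R 1 x).fst i = 2 * c - x.fst i := by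
  simp only [sliceFlow_fst_self, turned, speed_of_lt hx, one_mul, Complex.exp_pi_mul_I]
  ring

/-! ### Smoothness of the slice isotopy -/

theorem contDiff_energy (i : Fin d) (c : ℝ) : ContDiff ℝ ∞ (energy i c) :=
  (contDiff_normSq.comp ((contDiff_fst_apply i).sub contDiff_const)).add (contDiff_height.pow 2)

theorem contDiff_speed_energy (i : Fin d) (c R : ℝ) :
    ContDiff ℝ ∞ fun q : ℝ × Ambient d => speed R (energy i c q.2) :=
  (contDiff_speed R).comp ((contDiff_energy i c).comp contDiff_snd)

end

section

variable {d : ℕ}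

theorem contDiff_exp_ofReal_mul_I : ContDiff ℝ ∞ fun r : ℝ => Complex.exp ((r : ℂ) * Complex.I) :=
  (contDiff_complex_ofReal.mul contDiff_const).cexp

theorem contDiff_turned (i : Fin d) (c R : ℝ) :
    ContDiff ℝ ∞ fun q : ℝ × Ambient d => turned i c R q.1 q.2 :=
  (contDiff_exp_ofReal_mul_I.comp (contDiff_fst.mul (contDiff_speed_energy i c R))).mul
    (((contDiff_fst_apply i).comp contDiff_snd).sub contDiff_const)

theorem contDiff_im_comp {E : Type*} [NormedAddCommGroup E] [NormedSpace ℝ E] {f : E → ℂ}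
    (hf : ContDiff ℝ ∞ f) : ContDiff ℝ ∞ fun e => (f e).im :=
  Complex.imCLM.contDiff.comp hf

theorem contDiff_phase (i : Fin d) (c R : ℝ) :
    ContDiff ℝ ∞ fun q : ℝ × Ambient d => phase i c R q.1 q.2 := by
  have h1 := contDiff_im_comp (contDiff_turned i c R)
  have h2 : ContDiff ℝ ∞ fun q : ℝ × Ambient d => (q.2.fst i - (c : ℂ)).im :=
    contDiff_im_comp (((contDiff_fst_apply i).comp contDiff_snd).sub contDiff_const)
  have h3 : ContDiff ℝ ∞ fun q : ℝ × Ambient d => q.2.snd := contDiff_height.comp contDiff_snd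
  have h4 := contDiff_speed_energy i c R
  have h5 : ContDiff ℝ ∞ fun q : ℝ × Ambient d => energy i c q.2 :=
    (contDiff_energy i c).comp contDiff_snd
  exact (contDiff_const.mul (h1.sub h2)).sub (contDiff_fst.mul
    (((h3.pow 2).mul h4).add ((h5.mul h4).sub ((contDiff_profile R).comp h5))))

theorem contDiff_shift (i : Fin d) (c R : ℝ) :
    ContDiff ℝ ∞ fun q : ℝ × Ambient d => shift i c R q.1 q.2 :=
  contDiff_const.mul (contDiff_fst.mul
    ((contDiff_height.comp contDiff_snd).mul (contDiff_speed_energy i c R)))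

theorem contDiff_sliceFlow (i : Fin d) (c R : ℝ) :
    ContDiff ℝ ∞ fun q : ℝ × Ambient d => sliceFlow i c R q.1 q.2 := by
  refine contDiff_iff_contDiffAt.2 fun q => contDiffAt_ambient (fun j => ?_) ?_
  · by_cases hj : j = i
    · subst hj
      simp only [sliceFlow_fst_self]
      exact (contDiff_const.add (contDiff_turned j c R)).contDiffAt
    · simp only [sliceFlow_fst_of_ne hj]
      exact ((contDiff_exp_ofReal_mul_I.comp (contDiff_phase i c R)).mul
        ((contDiff_fst_apply j).comp contDiff_snd)).contDiffAt
  · exact (contDiff_height.comp contDiff_snd).contDiffAt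

theorem contDiff_phase_right (i : Fin d) (c R t : ℝ) : ContDiff ℝ ∞ (phase i c R t) := by
  have h := (contDiff_phase i c R).comp ((contDiff_const (c := t)).prodMk contDiff_id)
  exact h

theorem contDiff_shift_right (i : Fin d) (c R t : ℝ) : ContDiff ℝ ∞ (shift i c R t) := by
  have h := (contDiff_shift i c R).comp ((contDiff_const (c := t)).prodMk contDiff_id)
  exact h

theorem contDiff_sliceFlow_right (i : Fin d) (c R t : ℝ) : ContDiff ℝ ∞ (sliceFlow i c R t) := by
  have h := (contDiff_sliceFlow i c R).comp ((contDiff_const (c := t)).prodMk contDiff_id)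
  exact h

/-! ### Maps of `ℂ × (ℂ^d × ℝ)` rescaling the contact form -/

/-- The form `h dθ + (1/2) ∑ⱼ (xⱼ dyⱼ - yⱼ dxⱼ)` on `ℂ × (ℂ^d × ℝ)`. -/
def ambientBeta (P W : ℂ × Ambient d) : ℝ :=
  P.2.snd * ((conj P.1 * W.1).im / (2 * Real.pi))
    + 1 / 2 * ∑ j : Fin d, (conj (P.2.fst j) * W.2.fst j).im

/-- The differential of `F` at `P` multiplies `ambientBeta` by `k`. -/
def IsConformalAt (F : ℂ × Ambient d → ℂ × Ambient d) (k : ℝ) (P : ℂ × Ambient d) : Prop :=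
  DifferentiableAt ℝ F P ∧ ∀ W, ambientBeta (F P) (fderiv ℝ F P W) = k * ambientBeta P W

theorem IsConformalAt.comp {F G : ℂ × Ambient d → ℂ × Ambient d} {k l : ℝ} {P : ℂ × Ambient d}
    (hG : IsConformalAt G l (F P)) (hF : IsConformalAt F k P) :
    IsConformalAt (G ∘ F) (l * k) P := by
  refine ⟨hG.1.comp P hF.1, fun W => ?_⟩
  rw [fderiv_comp P hG.1 hF.1, ContinuousLinearMap.comp_apply, Function.comp_apply, hG.2, hF.2,
    mul_assoc]

theorem isConformalAt_id (P : ℂ × Ambient d) : IsConformalAt id 1 P :=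
  ⟨differentiableAt_id, fun W => by simp⟩

/-- Testing the differential along curves reduces the contact computations to one-variable
derivatives. -/
theorem isConformalAt_of_curves {F : ℂ × Ambient d → ℂ × Ambient d} {k : ℝ} {P : ℂ × Ambient d}
    (hF : DifferentiableAt ℝ F P)
    (h : ∀ (f : ℝ → ℂ × Ambient d) (W W' : ℂ × Ambient d), f 0 = P → HasDerivAt f W 0 →
      HasDerivAt (fun e => F (f e)) W' 0 → ambientBeta (F P) W' = k * ambientBeta P W) :
    IsConformalAt F k P := by
  refine ⟨hF, fun W => ?_⟩
  have hl : HasDerivAt (fun e : ℝ => P + e • W) W 0 := by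
    simpa using ((hasDerivAt_id (0 : ℝ)).smul_const W).const_add P
  have h0 : P + (0 : ℝ) • W = P := by simp
  refine h _ W _ h0 hl ?_
  have hF' : HasFDerivAt F (fderiv ℝ F P) (P + (0 : ℝ) • W) := by rw [h0]; exact hF.hasFDerivAt
  exact hF'.comp_hasDerivAt (0 : ℝ) hl

theorem hasDerivAt_circlePart {f : ℝ → ℂ × Ambient d} {W : ℂ × Ambient d} {a : ℝ}
    (hf : HasDerivAt f W a) : HasDerivAt (fun e => (f e).1) W.1 a :=
  (ContinuousLinearMap.fst ℝ ℂ (Ambient d)).hasFDerivAt.comp_hasDerivAt a hf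

theorem hasDerivAt_ambientPart {f : ℝ → ℂ × Ambient d} {W : ℂ × Ambient d} {a : ℝ}
    (hf : HasDerivAt f W a) : HasDerivAt (fun e => (f e).2) W.2 a :=
  (ContinuousLinearMap.snd ℝ ℂ (Ambient d)).hasFDerivAt.comp_hasDerivAt a hf

theorem hasDerivAt_fst_apply {f : ℝ → Ambient d} {W : Ambient d} {a : ℝ}
    (hf : HasDerivAt f W a) (j : Fin d) : HasDerivAt (fun e => (f e).fst j) (W.fst j) a :=
  ((EuclideanSpace.proj (𝕜 := ℂ) j).restrictScalars ℝ ∘L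
    (ContinuousLinearMap.fst ℝ _ _) ∘L
      (WithLp.prodContinuousLinearEquiv 2 ℝ (EuclideanSpace ℂ (Fin d)) ℝ).toContinuousLinearMap
    ).hasFDerivAt.comp_hasDerivAt a hf

theorem hasDerivAt_height {f : ℝ → Ambient d} {W : Ambient d} {a : ℝ}
    (hf : HasDerivAt f W a) : HasDerivAt (fun e => (f e).snd) W.snd a :=
  ((ContinuousLinearMap.snd ℝ _ _) ∘L
      (WithLp.prodContinuousLinearEquiv 2 ℝ (EuclideanSpace ℂ (Fin d)) ℝ).toContinuousLinearMap
    ).hasFDerivAt.comp_hasDerivAt a hf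

/-- Rotation by a variable angle r adds |z|² dr to Im(z̄ dz). This is applied to the circle factor,
to z_i - c and to each z_j with j ≠ i. -/
theorem im_conj_mul_exp_curve {z : ℝ → ℂ} {z' : ℂ} {r : ℝ → ℝ} {r' a : ℝ} {v : ℂ}
    (hz : HasDerivAt z z' a) (hr : HasDerivAt r r' a)
    (hv : HasDerivAt (fun e => Complex.exp ((r e : ℂ) * Complex.I) * z e) v a) :
    (conj (Complex.exp ((r a : ℂ) * Complex.I) * z a) * v).im
      = r' * Complex.normSq (z a) + (conj (z a) * z').im := by
  have hE : HasDerivAt (fun e => Complex.exp ((r e : ℂ) * Complex.I))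
      (Complex.exp ((r a : ℂ) * Complex.I) * ((r' : ℂ) * Complex.I)) a :=
    (hr.ofReal_comp.mul_const Complex.I).cexp
  rw [hv.unique (hE.mul hz)]
  have hn : conj (Complex.exp ((r a : ℂ) * Complex.I)) * Complex.exp ((r a : ℂ) * Complex.I) = 1 := by
    rw [mul_comm, Complex.mul_conj, normSq_exp_ofReal_mul_I, Complex.ofReal_one]
  have e : conj (Complex.exp ((r a : ℂ) * Complex.I) * z a)
      * (Complex.exp ((r a : ℂ) * Complex.I) * ((r' : ℂ) * Complex.I) * z a
        + Complex.exp ((r a : ℂ) * Complex.I) * z')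
      = ((r' * Complex.normSq (z a) : ℝ) : ℂ) * Complex.I + conj (z a) * z' := by
    push_cast
    rw [← Complex.mul_conj, map_mul]
    linear_combination (conj (z a) * (r' * Complex.I * z a + z')) * hn
  rw [e, Complex.add_im, Complex.im_ofReal_mul, Complex.I_im, mul_one]

/-- The derivative of r contributes only Im(z̄ z) r dr = 0, and the form has no dh term, so a
variable factor acts like a constant one. -/
theorem isConformalAt_wscale {r : Ambient d → ℝ} {P : ℂ × Ambient d}
    (hr : ContDiffAt ℝ ∞ r P.2) :
    IsConformalAt (fun Q => (Q.1, wscale (r Q.2) Q.2)) (r P.2 ^ 2) P := by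
  have hw : ContDiffAt ℝ ∞ (fun x : Ambient d => wscale (r x) x) P.2 :=
    contDiffAt_wscale hr contDiffAt_id
  refine isConformalAt_of_curves
    (differentiableAt_fst.prodMk ((hw.differentiableAt (by simp)).comp P differentiableAt_snd)) ?_
  intro f W W' h0 hf hF
  have hF1 : HasDerivAt (fun e => (f e).1) W'.1 0 := by
    have h := hasDerivAt_circlePart hF
    exact h
  have hu : W'.1 = W.1 := hF1.unique (hasDerivAt_circlePart hf)
  have hr' : HasDerivAt (fun e => r (f e).2) (fderiv ℝ r P.2 W.2) 0 := by
    have : HasFDerivAt r (fderiv ℝ r P.2) (f 0).2 := by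
      rw [h0]; exact (hr.differentiableAt (by simp)).hasFDerivAt
    exact this.comp_hasDerivAt (0 : ℝ) (hasDerivAt_ambientPart hf)
  have hz : ∀ j, (conj (r P.2 * P.2.fst j) * W'.2.fst j).im
      = r P.2 ^ 2 * (conj (P.2.fst j) * W.2.fst j).im := by
    intro j
    have h1 := hasDerivAt_fst_apply (hasDerivAt_ambientPart hf) j
    have h2 := hasDerivAt_fst_apply (hasDerivAt_ambientPart hF) j
    rw [h2.unique (hr'.ofReal_comp.mul h1), h0]
    simp only [Complex.mul_im, Complex.mul_re, Complex.add_im, Complex.add_re, map_mul,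
      Complex.conj_re, Complex.conj_im, Complex.ofReal_re, Complex.ofReal_im]
    ring
  simp only [ambientBeta, wscale_snd, wscale_fst, hz, hu, ← Finset.mul_sum]
  ring

/-- Write X for the speed and Ξ for the profile at E. The circle turns by 2π t h X and z_i - c by t
X, so up to the factor 1/2 the form changes by c times the change of Im dz_i, plus t (E - h²) dX + 2
t h d(h X). The last two terms equal t d(h² X + E X - Ξ) because dΞ = X dE. Everything is thus
exact, and the angle `phase` is minus its primitive, with weight ∑_{j ≠ i} |z_j|² = 1. The identity
holds for all ambient vectors, not only those tangent to the slice. -/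
theorem isConformalAt_sliceFlow (i : Fin d) (c R t : ℝ) {P : ℂ × Ambient d}
    (hu : Complex.normSq P.1 = 1) (hm : restNormSq i P.2 = 1) :
    IsConformalAt (fun Q => (Complex.exp ((shift i c R t Q.2 : ℂ) * Complex.I) * Q.1,
      sliceFlow i c R t Q.2)) 1 P := by
  have hS := contDiff_sliceFlow_right i c R t
  have hG := contDiff_shift_right i c R t
  have hA := contDiff_phase_right i c R t
  have hE : ContDiff ℝ ∞ fun Q : ℂ × Ambient d =>
      Complex.exp ((shift i c R t Q.2 : ℂ) * Complex.I) * Q.1 :=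
    (contDiff_exp_ofReal_mul_I.comp (hG.comp contDiff_snd)).mul contDiff_fst
  have hF : ContDiff ℝ ∞ fun Q : ℂ × Ambient d =>
      (Complex.exp ((shift i c R t Q.2 : ℂ) * Complex.I) * Q.1, sliceFlow i c R t Q.2) :=
    hE.prodMk (hS.comp contDiff_snd)
  refine isConformalAt_of_curves (hF.differentiable (by simp) P) ?_
  intro f W W' h0 hf hF
  have hx := hasDerivAt_ambientPart hf
  have along : ∀ {g : Ambient d → ℝ}, ContDiff ℝ ∞ g →
      ∃ g', HasDerivAt (fun e => g (f e).2) g' 0 := fun hg =>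
    ⟨_, (hg.differentiable (by simp) _).hasFDerivAt.comp_hasDerivAt (0 : ℝ) hx⟩
  obtain ⟨q', hq⟩ := along (contDiff_energy i c)
  obtain ⟨X', hX⟩ := along ((contDiff_speed R).comp (contDiff_energy i c))
  obtain ⟨γ', hγ⟩ := along hG
  obtain ⟨α', hα⟩ := along hA
  have hh := hasDerivAt_height hx
  have hτ : HasDerivAt (fun e => t * speed R (energy i c (f e).2)) (t * X') 0 := hX.const_mul t
  have hwi := (hasDerivAt_fst_apply hx i).sub_const (c : ℂ)
  have hci : HasDerivAt (fun e => turned i c R t (f e).2) (W'.2.fst i) 0 := by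
    have := (hasDerivAt_fst_apply (hasDerivAt_ambientPart hF) i).sub_const (c : ℂ)
    simpa using this
  -- Since the profile has derivative `speed`, the q' terms cancel in the derivative of E X - Ξ,
  -- leaving E X'.
  have hΞ : HasDerivAt (fun e => profile R (energy i c (f e).2)) (speed R (energy i c P.2) * q') 0 := by
    have := (hasDerivAt_profile R (energy i c (f 0).2)).comp (0 : ℝ) hq
    rwa [h0] at this
  have him : ∀ {g : ℝ → ℂ} {g' : ℂ}, HasDerivAt g g' 0 → HasDerivAt (fun e => (g e).im) g'.im 0 :=
    fun h => Complex.imCLM.hasFDerivAt.comp_hasDerivAt (0 : ℝ) h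
  -- the values of the derivatives of the two compensating angles
  have eγ : γ' = 2 * Real.pi * (t * (W.2.snd * speed R (energy i c P.2) + P.2.snd * X')) := by
    have := hγ.unique (((hh.mul hX).const_mul t).const_mul (2 * Real.pi))
    simpa [h0] using this
  have eα : α' = -c * ((W'.2.fst i).im - (W.2.fst i).im)
      - t * (2 * P.2.snd * W.2.snd * speed R (energy i c P.2) + P.2.snd ^ 2 * X'
        + energy i c P.2 * X') := by
    have := hα.unique (((((him hci).sub (him hwi)).const_mul (-c))).sub
      ((((hh.pow 2).mul hX).add ((hq.mul hX).sub hΞ)).const_mul t))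
    rw [this]
    simp only [h0, Pi.pow_apply, Function.comp_apply, Nat.cast_ofNat, Nat.reduceSub, pow_one]
    ring
  -- the contributions of the coordinates
  have hcircle : (conj (Complex.exp ((shift i c R t P.2 : ℂ) * Complex.I) * P.1) * W'.1).im
      = γ' + (conj P.1 * W.1).im := by
    have := im_conj_mul_exp_curve (hasDerivAt_circlePart hf) hγ (hasDerivAt_circlePart hF)
    rwa [h0, hu, mul_one] at this
  have hi : (conj (c + turned i c R t P.2) * W'.2.fst i).im
      = t * X' * Complex.normSq (P.2.fst i - c) + (conj (P.2.fst i) * W.2.fst i).im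
        + c * ((W'.2.fst i).im - (W.2.fst i).im) := by
    have := im_conj_mul_exp_curve hwi hτ hci
    rw [h0] at this
    change (conj (turned i c R t P.2) * W'.2.fst i).im = _ at this
    -- Rotating about c rather than 0 is what produces the extra term in c: the form is not
    -- translation invariant.
    rw [map_add, add_mul, Complex.add_im, this]
    simp
    ring
  have hj : ∀ j ∈ Finset.univ.erase i,
      (conj ((sliceFlow i c R t P.2).fst j) * W'.2.fst j).im
        = α' * Complex.normSq (P.2.fst j) + (conj (P.2.fst j) * W.2.fst j).im := by
    intro j hj
    have hj := Finset.ne_of_mem_erase hj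
    have h2 := hasDerivAt_fst_apply (hasDerivAt_ambientPart hF) j
    simp only [sliceFlow_fst_of_ne hj] at h2
    have := im_conj_mul_exp_curve (hasDerivAt_fst_apply hx j) hα h2
    rwa [h0, ← sliceFlow_fst_of_ne hj] at this
  have hsum : ∑ j ∈ Finset.univ.erase i, Complex.normSq (P.2.fst j) = 1 := hm
  simp only [ambientBeta, sliceFlow_snd, hcircle]
  rw [← Finset.add_sum_erase _ _ (Finset.mem_univ i), sliceFlow_fst_self, hi,
    Finset.sum_congr rfl hj, Finset.sum_add_distrib, ← Finset.mul_sum, hsum,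
    ← Finset.add_sum_erase _ (fun j => (conj (P.2.fst j) * W.2.fst j).im) (Finset.mem_univ i),
    eα, eγ]
  have hpi := Real.pi_ne_zero
  have hE : Complex.normSq (P.2.fst i - c) = energy i c P.2 - P.2.snd ^ 2 := by simp [energy]
  rw [hE]
  field_simp
  ring

end

section

variable {d : ℕ}

/-! ### The isotopy of the sphere -/

/-- The map of the sphere induced by `sliceFlow`. -/
def sphereFlow (i : Fin d) (c R t : ℝ) (x : Ambient d) : Ambient d :=
  if restNormSq i x = 0 then x else toSphere (sliceFlow i c R t (toSlice i x))

/-- The angle by which the circle factor is rotated over a point of the sphere. -/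
def angle (i : Fin d) (c R t : ℝ) (x : Ambient d) : ℝ :=
  if restNormSq i x = 0 then 0 else shift i c R t (toSlice i x)

theorem restNormSq_pos_of_ne {i : Fin d} {x : Ambient d} (h : restNormSq i x ≠ 0) :
    0 < restNormSq i x := (restNormSq_nonneg i x).lt_of_ne' h

theorem restNormSq_sliceFlow_toSlice {i : Fin d} (c R t : ℝ) {x : Ambient d}
    (h : restNormSq i x ≠ 0) : restNormSq i (sliceFlow i c R t (toSlice i x)) = 1 := by
  rw [restNormSq_sliceFlow, restNormSq_toSlice (restNormSq_pos_of_ne h)]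

theorem zNormSq_sliceFlow_toSlice_pos {i : Fin d} (c R t : ℝ) {x : Ambient d}
    (h : restNormSq i x ≠ 0) : 0 < zNormSq (sliceFlow i c R t (toSlice i x)) :=
  zNormSq_pos (i := i) (by rw [restNormSq_sliceFlow_toSlice c R t h]; exact one_pos)

theorem norm_sphereFlow (i : Fin d) (c R t : ℝ) {x : Ambient d} (hx : ‖x‖ = 1) :
    ‖sphereFlow i c R t x‖ = 1 := by
  unfold sphereFlow
  split_ifs with h
  · exact hx
  · exact norm_toSphere (zNormSq_sliceFlow_toSlice_pos c R t h)

theorem restNormSq_sphereFlow_ne {i : Fin d} (c R t : ℝ) {x : Ambient d}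
    (h : restNormSq i x ≠ 0) : restNormSq i (sphereFlow i c R t x) ≠ 0 := by
  rw [sphereFlow, if_neg h]
  exact (restNormSq_toSphere_pos (by rw [restNormSq_sliceFlow_toSlice c R t h]; exact one_pos)).ne'

theorem toSlice_sphereFlow {i : Fin d} (c R t : ℝ) {x : Ambient d} (h : restNormSq i x ≠ 0) :
    toSlice i (sphereFlow i c R t x) = sliceFlow i c R t (toSlice i x) := by
  rw [sphereFlow, if_neg h, toSlice_toSphere (restNormSq_sliceFlow_toSlice c R t h)]

theorem sphereFlow_add (i : Fin d) (c R s t : ℝ) (x : Ambient d) :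
    sphereFlow i c R s (sphereFlow i c R t x) = sphereFlow i c R (s + t) x := by
  by_cases h : restNormSq i x = 0
  · simp [sphereFlow, h]
  · rw [sphereFlow, if_neg (restNormSq_sphereFlow_ne c R t h), toSlice_sphereFlow c R t h,
      sliceFlow_add, sphereFlow, if_neg h]

theorem angle_add (i : Fin d) (c R s t : ℝ) (x : Ambient d) :
    angle i c R s (sphereFlow i c R t x) + angle i c R t x = angle i c R (s + t) x := by
  by_cases h : restNormSq i x = 0
  · simp [angle, sphereFlow, h]
  · rw [angle, if_neg (restNormSq_sphereFlow_ne c R t h), toSlice_sphereFlow c R t h, angle,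
      if_neg h, shift_sliceFlow, angle, if_neg h]

theorem sphereFlow_zero (i : Fin d) (c R : ℝ) {x : Ambient d} (hx : ‖x‖ = 1) :
    sphereFlow i c R 0 x = x := by
  unfold sphereFlow
  split_ifs with h
  · rfl
  · rw [sliceFlow_zero, toSphere_toSlice (restNormSq_pos_of_ne h) hx]

theorem angle_zero (i : Fin d) (c R : ℝ) (x : Ambient d) : angle i c R 0 x = 0 := by
  simp [angle, shift_zero]

/-! ### Triviality of the flow near the excluded locus -/

/-- With m = ∑_{j ≠ i} |z_j|², the sphere equation in slice coordinates y reads m (|y_i|² + 1) + m²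
h² = 1. Bounded energy bounds |y_i|² by 2K + 2c² and h² by K, so m cannot be small. -/
theorem one_le_of_energy_le {i : Fin d} {c K : ℝ} {x : Ambient d} (hx : ‖x‖ = 1)
    (hm : 0 < restNormSq i x) (hE : energy i c (toSlice i x) ≤ K) :
    1 ≤ (3 * K + 2 * c ^ 2 + 1) * restNormSq i x := by
  set y := toSlice i x
  have e : x = wscale (√(restNormSq i x)) y := by
    change x = wscale _ (wscale _ x)
    rw [wscale_wscale, mul_inv_cancel₀ (by positivity), wscale_one]
  have hy : restNormSq i y = 1 := restNormSq_toSlice hm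
  have h1 : restNormSq i x * (Complex.normSq (y.fst i) + 1)
      + restNormSq i x ^ 2 * y.snd ^ 2 = 1 := by
    have h := (norm_eq_one_iff x).1 hx
    rw [e, zNormSq_wscale, wscale_snd, Real.sq_sqrt hm.le, zNormSq_eq i y, hy] at h
    linear_combination h
  generalize restNormSq i x = m at *
  have h2 : Complex.normSq (y.fst i) ≤ 2 * Complex.normSq (y.fst i - c) + 2 * c ^ 2 := by
    simp only [Complex.normSq_apply, Complex.sub_re, Complex.sub_im, Complex.ofReal_re,
      Complex.ofReal_im]
    nlinarith [sq_nonneg ((y.fst i).re - 2 * c), sq_nonneg (y.fst i).im]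
  have hE' : Complex.normSq (y.fst i - c) + y.snd ^ 2 ≤ K := hE
  have h3 := Complex.normSq_nonneg (y.fst i - c)
  have h4 := Complex.normSq_nonneg (y.fst i)
  have h5 := sq_nonneg y.snd
  -- This permits replacing m² by m in the height term.
  have hm1 : m ≤ 1 := by nlinarith [mul_nonneg hm.le h4, mul_nonneg (sq_nonneg m) h5]
  have h6 : m * Complex.normSq (y.fst i) ≤ m * (2 * K + 2 * c ^ 2) := by gcongr; linarith
  have h7 : m ^ 2 * y.snd ^ 2 ≤ m * K := by
    have : m ^ 2 ≤ m := by nlinarith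
    calc m ^ 2 * y.snd ^ 2 ≤ m * y.snd ^ 2 := by gcongr
      _ ≤ m * K := by gcongr; linarith
  linarith

theorem exists_flow_eq_self (i : Fin d) (c R : ℝ) : ∃ δ > 0, ∀ (t : ℝ) (x : Ambient d),
    ‖x‖ = 1 → restNormSq i x < δ → sphereFlow i c R t x = x ∧ angle i c R t x = 0 := by
  -- The absolute value makes the constant positive for every R; its inverse serves as δ.
  have hC : 0 < 3 * |R + 1| + 2 * c ^ 2 + 1 := by positivity
  refine ⟨_, inv_pos.2 hC, fun t x hx hm => ?_⟩
  by_cases h : restNormSq i x = 0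
  · simp [sphereFlow, angle, h]
  · have hp := restNormSq_pos_of_ne h
    have hE : R + 1 < energy i c (toSlice i x) := by
      by_contra! hE
      have h1 := one_le_of_energy_le hx hp (hE.trans (le_abs_self _))
      have h2 : (3 * |R + 1| + 2 * c ^ 2 + 1) * restNormSq i x < 1 := by
        rwa [← lt_inv_mul_iff₀ hC, mul_one]
      linarith
    rw [sphereFlow, angle, if_neg h, if_neg h, sliceFlow_of_energy_gt t hE,
      shift_of_energy_gt t hE, toSphere_toSlice hp hx]
    exact ⟨rfl, rfl⟩

/-! ### Smoothness and conformality away from the excluded locus -/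

theorem eventually_restNormSq_ne {i : Fin d} {x : Ambient d} (h : restNormSq i x ≠ 0) :
    ∀ᶠ y in nhds x, restNormSq i y ≠ 0 :=
  (contDiff_restNormSq i).continuous.continuousAt.eventually_ne h

theorem contDiffAt_toSlice_snd {i : Fin d} {q : ℝ × Ambient d} (h : restNormSq i q.2 ≠ 0) :
    ContDiffAt ℝ ∞ (fun q : ℝ × Ambient d => (q.1, toSlice i q.2)) q :=
  contDiffAt_fst.prodMk ((contDiffAt_toSlice (restNormSq_pos_of_ne h)).comp q contDiffAt_snd)

theorem contDiffAt_angle {i : Fin d} (c R : ℝ) {q : ℝ × Ambient d} (h : restNormSq i q.2 ≠ 0) :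
    ContDiffAt ℝ ∞ (fun q : ℝ × Ambient d => angle i c R q.1 q.2) q := by
  have h1 := (contDiff_shift i c R).contDiffAt.comp q (contDiffAt_toSlice_snd h)
  refine h1.congr_of_eventuallyEq ?_
  filter_upwards [continuousAt_snd.eventually (eventually_restNormSq_ne h)] with r hr
  exact if_neg hr

theorem contDiffAt_sphereFlow {i : Fin d} (c R : ℝ) {q : ℝ × Ambient d}
    (h : restNormSq i q.2 ≠ 0) :
    ContDiffAt ℝ ∞ (fun q : ℝ × Ambient d => sphereFlow i c R q.1 q.2) q := by
  have h1 := (contDiff_sliceFlow i c R).contDiffAt.comp q (contDiffAt_toSlice_snd h)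
  have h2 := (contDiffAt_toSphere (zNormSq_sliceFlow_toSlice_pos c R q.1 h)).comp q h1
  refine h2.congr_of_eventuallyEq ?_
  filter_upwards [continuousAt_snd.eventually (eventually_restNormSq_ne h)] with r hr
  exact if_neg hr

/-- The map is a scaling to the slice, the slice flow and a scaling back to the sphere. The
conformal factors are positive, 1 and positive. -/
theorem exists_isConformalAt_flow {i : Fin d} (c R t : ℝ) {P : ℂ × Ambient d}
    (hu : Complex.normSq P.1 = 1) (h : restNormSq i P.2 ≠ 0) :
    ∃ k ≠ 0, IsConformalAt (fun Q => (Complex.exp ((shift i c R t (toSlice i Q.2) : ℂ) * Complex.I)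
      * Q.1, toSphere (sliceFlow i c R t (toSlice i Q.2)))) k P := by
  have hp := restNormSq_pos_of_ne h
  have hz := zNormSq_sliceFlow_toSlice_pos c R t h
  have h1 := isConformalAt_wscale (P := P) (contDiffAt_sliceFactor hp)
  have h2 := isConformalAt_sliceFlow i c R t (P := (P.1, toSlice i P.2)) hu (restNormSq_toSlice hp)
  have h3 := isConformalAt_wscale
    (P := (Complex.exp ((shift i c R t (toSlice i P.2) : ℂ) * Complex.I) * P.1,
      sliceFlow i c R t (toSlice i P.2))) (contDiffAt_sphereFactor hz)
  have h4 := h3.comp (h2.comp h1)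
  refine ⟨_, ?_, h4⟩
  have h5 := sphereFactor_pos hz
  positivity

/-! ### The isotopy of `S¹ × S^{2d}` -/

theorem norm_coe_sphere (x : Metric.sphere (0 : Ambient d) 1) : ‖(x : Ambient d)‖ = 1 :=
  mem_sphere_zero_iff_norm.1 x.2

/-- The map of `S¹ × S^{2d}` induced by `sliceFlow`. -/
def flow (i : Fin d) (c R t : ℝ) (p : V d) : V d :=
  (Circle.exp (angle i c R t p.2) * p.1, ⟨sphereFlow i c R t p.2,
    mem_sphere_zero_iff_norm.2 (norm_sphereFlow i c R t (norm_coe_sphere p.2))⟩)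

theorem flow_add (i : Fin d) (c R s t : ℝ) (p : V d) :
    flow i c R s (flow i c R t p) = flow i c R (s + t) p := by
  refine Prod.ext ?_ (Subtype.ext (sphereFlow_add i c R s t p.2))
  change Circle.exp (angle i c R s (sphereFlow i c R t p.2)) * (Circle.exp (angle i c R t p.2) * p.1)
    = Circle.exp (angle i c R (s + t) p.2) * p.1
  rw [← mul_assoc, ← Circle.exp_add, angle_add]

theorem flow_zero (i : Fin d) (c R : ℝ) (p : V d) : flow i c R 0 p = p := by
  refine Prod.ext ?_ (Subtype.ext (sphereFlow_zero i c R (norm_coe_sphere p.2)))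
  change Circle.exp (angle i c R 0 p.2) * p.1 = p.1
  rw [angle_zero, Circle.exp_zero, one_mul]

/-! ### Smoothness on the manifold -/

theorem contMDiff_coe_circle : ContMDiff (𝓡 1) 𝓘(ℝ, ℂ) ∞ (fun u : Circle => (u : ℂ)) :=
  haveI := finrank_real_complex_fact'
  contMDiff_coe_sphere (E := ℂ) (n := 1)

theorem contMDiff_coe_ambient : ContMDiff (𝓡 (2 * d)) 𝓘(ℝ, Ambient d) ∞
    (fun x : Metric.sphere (0 : Ambient d) 1 => (x : Ambient d)) :=
  contMDiff_coe_sphere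

theorem contMDiff_incl : ContMDiff (model d) 𝓘(ℝ, ℂ × Ambient d) ∞ (incl d) :=
  (contMDiff_coe_circle.comp contMDiff_fst).prodMk_space (contMDiff_coe_ambient.comp contMDiff_snd)

theorem contMDiff_timeAmbient : ContMDiff (𝓘(ℝ, ℝ).prod (model d)) 𝓘(ℝ, ℝ × Ambient d) ∞
    (fun q : ℝ × V d => (q.1, (q.2.2 : Ambient d))) :=
  contMDiff_fst.prodMk_space (contMDiff_coe_ambient.comp (contMDiff_snd.comp contMDiff_snd))

theorem eventually_restNormSq_lt {i : Fin d} {q : ℝ × V d} {δ : ℝ}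
    (h : restNormSq i (q.2.2 : Ambient d) < δ) :
    ∀ᶠ r : ℝ × V d in nhds q, restNormSq i (r.2.2 : Ambient d) < δ := by
  have hc : Continuous fun r : ℝ × V d => restNormSq i (r.2.2 : Ambient d) :=
    (contDiff_restNormSq i).continuous.comp (by fun_prop)
  exact hc.continuousAt.eventually_lt continuousAt_const h

/-- Two overlapping open sets are used: near the excluded locus the map is the inclusion for all
times at once, and elsewhere it is a composite of smooth ambient maps. -/
theorem contMDiff_sphereFlow (i : Fin d) (c R : ℝ) :
    ContMDiff (𝓘(ℝ, ℝ).prod (model d)) 𝓘(ℝ, Ambient d) ∞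
      (fun q : ℝ × V d => sphereFlow i c R q.1 (q.2.2 : Ambient d)) := by
  intro q
  by_cases h : restNormSq i (q.2.2 : Ambient d) = 0
  · obtain ⟨δ, hδ, H⟩ := exists_flow_eq_self i c R
    have h1 : ContMDiff (𝓘(ℝ, ℝ).prod (model d)) 𝓘(ℝ, Ambient d) ∞
        (fun q : ℝ × V d => (q.2.2 : Ambient d)) :=
      contMDiff_coe_ambient.comp (contMDiff_snd.comp contMDiff_snd)
    refine h1.contMDiffAt.congr_of_eventuallyEq ?_
    filter_upwards [eventually_restNormSq_lt (h.trans_lt hδ)] with r hr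
    exact (H _ _ (norm_coe_sphere _) hr).1
  · have h1 : ContMDiffAt 𝓘(ℝ, ℝ × Ambient d) 𝓘(ℝ, Ambient d) ∞
        (fun q : ℝ × Ambient d => sphereFlow i c R q.1 q.2) (q.1, (q.2.2 : Ambient d)) :=
      (contDiffAt_sphereFlow c R (q := (q.1, (q.2.2 : Ambient d))) h).contMDiffAt
    exact h1.comp q (contMDiff_timeAmbient q)

theorem contMDiff_angle (i : Fin d) (c R : ℝ) :
    ContMDiff (𝓘(ℝ, ℝ).prod (model d)) 𝓘(ℝ, ℝ) ∞
      (fun q : ℝ × V d => angle i c R q.1 (q.2.2 : Ambient d)) := by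
  intro q
  by_cases h : restNormSq i (q.2.2 : Ambient d) = 0
  · obtain ⟨δ, hδ, H⟩ := exists_flow_eq_self i c R
    have h1 : ContMDiff (𝓘(ℝ, ℝ).prod (model d)) 𝓘(ℝ, ℝ) ∞ (fun _ : ℝ × V d => (0 : ℝ)) :=
      contMDiff_const
    refine h1.contMDiffAt.congr_of_eventuallyEq ?_
    filter_upwards [eventually_restNormSq_lt (h.trans_lt hδ)] with r hr
    exact (H _ _ (norm_coe_sphere _) hr).2
  · have h1 : ContMDiffAt 𝓘(ℝ, ℝ × Ambient d) 𝓘(ℝ, ℝ) ∞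
        (fun q : ℝ × Ambient d => angle i c R q.1 q.2) (q.1, (q.2.2 : Ambient d)) :=
      (contDiffAt_angle c R (q := (q.1, (q.2.2 : Ambient d))) h).contMDiffAt
    exact h1.comp q (contMDiff_timeAmbient q)

theorem contMDiff_flow (i : Fin d) (c R : ℝ) :
    ContMDiff (𝓘(ℝ, ℝ).prod (model d)) (model d) ∞
      (fun q : ℝ × V d => flow i c R q.1 q.2) := by
  have h1 : ContMDiff (𝓘(ℝ, ℝ).prod (model d)) (𝓡 1) ∞
      (fun q : ℝ × V d => Circle.exp (angle i c R q.1 (q.2.2 : Ambient d)) * q.2.1) :=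
    (contMDiff_circleExp.comp (contMDiff_angle i c R)).mul (contMDiff_fst.comp contMDiff_snd)
  have h2 := (contMDiff_sphereFlow i c R).codRestrict_sphere (n := 2 * d)
    (fun q => mem_sphere_zero_iff_norm.2 (norm_sphereFlow i c R q.1 (norm_coe_sphere q.2.2)))
  exact h1.prodMk h2

theorem contMDiff_flow_right (i : Fin d) (c R t : ℝ) :
    ContMDiff (model d) (model d) ∞ (flow i c R t) := by
  have h : ContMDiff (model d) (𝓘(ℝ, ℝ).prod (model d)) ∞ (fun p : V d => (t, p)) :=
    contMDiff_const.prodMk contMDiff_id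
  have h' := (contMDiff_flow i c R).comp h
  exact h'

/-- The map `flow` as a diffeomorphism. -/
def flowDiffeo (i : Fin d) (c R t : ℝ) : V d ≃ₘ^∞⟮model d, model d⟯ V d where
  toFun := flow i c R t
  invFun := flow i c R (-t)
  left_inv p := by rw [flow_add, neg_add_cancel, flow_zero]
  right_inv p := by rw [flow_add, add_neg_cancel, flow_zero]
  contMDiff_toFun := contMDiff_flow_right i c R t
  contMDiff_invFun := contMDiff_flow_right i c R (-t)

/-- Since β is defined through the inclusion, the chain rule turns a conformal ambient extension of
the germ of f at p into the corresponding statement on the manifold. -/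
theorem beta_mfderiv {f : V d → V d} {F : ℂ × Ambient d → ℂ × Ambient d} {k : ℝ} {p : V d}
    (hf : MDifferentiableAt (model d) (model d) f p) (hF : IsConformalAt F k (incl d p))
    (h : incl d ∘ f =ᶠ[nhds p] F ∘ incl d) (v : TangentSpace (model d) p) :
    beta (f p) (mfderiv (model d) (model d) f p v) = k * beta p v := by
  have hi : ∀ p, MDifferentiableAt (model d) 𝓘(ℝ, ℂ × Ambient d) (incl d) p := fun p =>
    contMDiff_incl.mdifferentiableAt (by simp)
  have e1 := mfderiv_comp p (hi (f p)) hf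
  have e2 := mfderiv_comp p (hF.1.mdifferentiableAt) (hi p)
  rw [mfderiv_eq_fderiv] at e2
  have e3 := h.mfderiv_eq (I := model d) (I' := 𝓘(ℝ, ℂ × Ambient d))
  have e4 : mfderiv (model d) 𝓘(ℝ, ℂ × Ambient d) (incl d) (f p)
      (mfderiv (model d) (model d) f p v)
      = fderiv ℝ F (incl d p) (mfderiv (model d) 𝓘(ℝ, ℂ × Ambient d) (incl d) p v) := by
    have a1 := DFunLike.congr_fun e1 v
    have a2 := DFunLike.congr_fun e2 v
    have a3 := DFunLike.congr_fun e3 v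
    exact a1.symm.trans (a3.trans a2)
  have e5 : incl d (f p) = F (incl d p) := h.eq_of_nhds
  change ambientBeta (incl d (f p)) (mfderiv (model d) 𝓘(ℝ, ℂ × Ambient d) (incl d) (f p)
      (mfderiv (model d) (model d) f p v)) = k * ambientBeta (incl d p) _
  rw [e4, e5]
  exact hF.2 _

theorem isContactomorphism_flowDiffeo (i : Fin d) (c R t : ℝ) :
    IsContactomorphism (flowDiffeo i c R t) := by
  intro p v
  have hf : MDifferentiableAt (model d) (model d) (flow i c R t) p :=
    (contMDiff_flow_right i c R t).mdifferentiableAt (by simp)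
  -- A nonzero conformal factor preserves the kernel. The extension F may depend on p: the identity
  -- near the excluded locus, the ambient flow elsewhere.
  suffices ∃ k ≠ 0, ∃ F, IsConformalAt F k (incl d p) ∧
      incl d ∘ flow i c R t =ᶠ[nhds p] F ∘ incl d by
    obtain ⟨k, hk, F, hF, h⟩ := this
    have := beta_mfderiv hf hF h v
    change beta (flow i c R t p) (mfderiv (model d) (model d) (flow i c R t) p v) = 0 ↔ _
    rw [this, mul_eq_zero, or_iff_right hk]
  have hc : Continuous fun p : V d => (p.2 : Ambient d) := by fun_prop
  by_cases h : restNormSq i (p.2 : Ambient d) = 0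
  · obtain ⟨δ, hδ, H⟩ := exists_flow_eq_self i c R
    refine ⟨1, one_ne_zero, id, isConformalAt_id _, ?_⟩
    have hlt : ∀ᶠ r : V d in nhds p, restNormSq i (r.2 : Ambient d) < δ :=
      ((contDiff_restNormSq i).continuous.comp hc).continuousAt.eventually_lt continuousAt_const
        (h.trans_lt hδ)
    filter_upwards [hlt] with r hr
    obtain ⟨h1, h2⟩ := H t _ (norm_coe_sphere r.2) hr
    simp [incl, flow, h1, h2]
  · obtain ⟨k, hk, hF⟩ := exists_isConformalAt_flow c R t (P := incl d p)
      (by simp [incl]) h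
    refine ⟨k, hk, _, hF, ?_⟩
    filter_upwards [hc.continuousAt.eventually (eventually_restNormSq_ne h)] with r hr
    simp [incl, flow, sphereFlow, angle, hr, Circle.coe_exp]

theorem isContactIsotopy_flowDiffeo (i : Fin d) (c R : ℝ) :
    IsContactIsotopy (flowDiffeo i c R) where
  smooth := (contMDiff_flow i c R).contMDiffOn
  contact t _ := isContactomorphism_flowDiffeo i c R t
  start p := flow_zero i c R p

/-! ### Displacing the toric fibers -/

theorem smul_fst_apply (t : Torus d) (p : V d) (j : Fin d) :
    ((t • p).2 : Ambient d).fst j = t.2 j * (p.2 : Ambient d).fst j := rfl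

theorem smul_snd (t : Torus d) (p : V d) :
    ((t • p).2 : Ambient d).snd = (p.2 : Ambient d).snd := rfl

/-- If z_j = 0, the whole j-th circle of the torus fixes p, and a circle is infinite. -/
theorem zCoord_ne_zero_of_finite_stabilizer {p : V d}
    (h : Finite (MulAction.stabilizer (Torus d) p)) (j : Fin d) : zCoord p j ≠ 0 := by
  intro hj
  have hmem : ∀ u : Circle, ((1, Pi.mulSingle j u) : Torus d) ∈ MulAction.stabilizer (Torus d) p := by
    intro u
    refine MulAction.mem_stabilizer_iff.2 (Prod.ext (one_mul _) (Subtype.ext ?_))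
    refine ambient_ext (fun k => ?_) rfl
    change ((Pi.mulSingle j u : Fin d → Circle) k : ℂ) * (p.2 : Ambient d).fst k = _
    by_cases hk : k = j
    · subst hk
      have : (p.2 : Ambient d).fst k = 0 := hj
      rw [this, mul_zero]
    · rw [Pi.mulSingle_eq_of_ne hk, Circle.coe_one, one_mul]
  have hinj : Function.Injective
      fun u : Circle => (⟨_, hmem u⟩ : MulAction.stabilizer (Torus d) p) := by
    intro u v huv
    have := congrFun (congrArg (fun s : MulAction.stabilizer (Torus d) p => (s : Torus d).2) huv) j
    simpa using this
  have := Finite.of_injective _ hinj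
  have : Finite (Set.Ioc (-Real.pi) Real.pi) := Finite.of_equiv _ Circle.argEquiv
  exact Set.Ioc_infinite (neg_lt_self Real.pi_pos) (Set.toFinite _)

theorem normSq_smul (t : Torus d) (p : V d) (j : Fin d) :
    Complex.normSq (((t • p).2 : Ambient d).fst j) = Complex.normSq ((p.2 : Ambient d).fst j) := by
  rw [smul_fst_apply, Complex.normSq_mul, Circle.normSq_coe, one_mul]

theorem restNormSq_smul (i : Fin d) (t : Torus d) (p : V d) :
    restNormSq i ((t • p).2 : Ambient d) = restNormSq i (p.2 : Ambient d) :=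
  Finset.sum_congr rfl fun j _ => normSq_smul t p j

theorem norm_toSlice_smul (i : Fin d) (t : Torus d) (p : V d) :
    ‖(toSlice i ((t • p).2 : Ambient d)).fst i‖ = ‖(toSlice i (p.2 : Ambient d)).fst i‖ := by
  rw [toSlice, toSlice, wscale_fst, wscale_fst, restNormSq_smul, smul_fst_apply, norm_mul, norm_mul,
    norm_mul, Circle.norm_coe, one_mul]

theorem toSlice_smul_snd (i : Fin d) (t : Torus d) (p : V d) :
    (toSlice i ((t • p).2 : Ambient d)).snd = (toSlice i (p.2 : Ambient d)).snd := by
  rw [toSlice, toSlice, wscale_snd, wscale_snd, restNormSq_smul, smul_snd]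

/-- Every pre-Lagrangian toric fiber is displaceable: after rescaling to the slice
`∑_{j ≠ i} |z_j|² = 1` it lies over a circle `|z_i| = ρ` and a fixed value of `h`, and the time-one
map of `flow` acts there by the point reflection `z_i ↦ 2c - z_i` with `c = ρ + 1`. -/
theorem isDisplaceable_of_isPreLagrangianToricFiber (hd : 2 ≤ d) {L : Set (V d)}
    (hL : IsPreLagrangianToricFiber L) : IsDisplaceable L := by
  obtain ⟨p, hp, rfl⟩ := hL
  let i : Fin d := ⟨0, by lia⟩
  let j : Fin d := ⟨1, by lia⟩
  -- A second index j ≠ i exists because d ≥ 2, and z_j ≠ 0 keeps the orbit off the excluded locus.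
  have hm : restNormSq i (p.2 : Ambient d) ≠ 0 := by
    have hj : j ∈ Finset.univ.erase i := by simp [i, j]
    have h1 : Complex.normSq ((p.2 : Ambient d).fst j) ≤ restNormSq i (p.2 : Ambient d) :=
      Finset.single_le_sum (f := fun j => Complex.normSq ((p.2 : Ambient d).fst j))
        (fun _ _ => Complex.normSq_nonneg _) hj
    exact ((Complex.normSq_pos.2 (zCoord_ne_zero_of_finite_stabilizer hp j)).trans_le h1).ne'
  set y := toSlice i (p.2 : Ambient d)
  set c := ‖y.fst i‖ + 1 with hc
  -- On the orbit |z_i - c| ≤ ρ + c < 2c, so E < R and time one is the exact point reflection there.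
  set R := (2 * c) ^ 2 + y.snd ^ 2 with hR
  have hy := norm_nonneg (y.fst i)
  refine ⟨flowDiffeo i c R, isContactIsotopy_flowDiffeo i c R, ?_⟩
  rw [Set.eq_empty_iff_forall_notMem]
  rintro _ ⟨⟨_, ⟨s, rfl⟩, rfl⟩, ⟨t, ht⟩⟩
  have hs : restNormSq i ((s • p).2 : Ambient d) ≠ 0 := by rwa [restNormSq_smul]
  set x := toSlice i ((s • p).2 : Ambient d) with hx
  have hxn : ‖x.fst i‖ = ‖y.fst i‖ := norm_toSlice_smul i s p
  have hE : energy i c x < R := by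
    have h1 : ‖x.fst i - c‖ < 2 * c := by
      calc ‖x.fst i - c‖ ≤ ‖x.fst i‖ + ‖(c : ℂ)‖ := norm_sub_le _ _
        _ = ‖y.fst i‖ + c := by rw [hxn, Complex.norm_real, Real.norm_of_nonneg (by positivity)]
        _ < 2 * c := by linarith
    have h2 : x.snd = y.snd := toSlice_smul_snd i s p
    rw [energy, Complex.normSq_eq_norm_sq, h2, hR]
    gcongr
  have h1 : toSlice i ((flow i c R 1 (s • p)).2 : Ambient d) = sliceFlow i c R 1 x :=
    toSlice_sphereFlow c R 1 hs
  have h2 : ‖2 * (c : ℂ) - x.fst i‖ = ‖y.fst i‖ := by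
    rw [← sliceFlow_one_of_energy_lt hE, ← h1]
    have ht' : t • p = flow i c R 1 (s • p) := ht
    rw [← ht']
    exact norm_toSlice_smul i t p
  -- If the image met the orbit, both z_i and 2c - z_i would have norm ρ, forcing 2c ≤ 2ρ against c
  -- = ρ + 1.
  have h3 : ‖2 * (c : ℂ)‖ ≤ ‖2 * (c : ℂ) - x.fst i‖ + ‖x.fst i‖ := by
    simpa using norm_add_le (2 * (c : ℂ) - x.fst i) (x.fst i)
  rw [h2, hxn, norm_mul, Complex.norm_real, Real.norm_of_nonneg (by positivity),
    Complex.norm_ofNat] at h3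
  linarith

end

end ContactToric

end

theorem proposition4p0 (d : ℕ) (hd : 2 ≤ d) :
    ∃ U : Set (ContactToric.V d), IsOpen U ∧ ContactToric.equator d ⊆ U ∧
      ∀ L : Set (ContactToric.V d), ContactToric.IsPreLagrangianToricFiber L → L ⊆ U →
        ContactToric.IsDisplaceable L :=
  ⟨Set.univ, isOpen_univ, Set.subset_univ _, fun _ hL _ =>
    ContactToric.isDisplaceable_of_isPreLagrangianToricFiber hd hL⟩
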